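/- Let $s=(s_1,\dots,s_n)$ be a composition, i.e. a sequence of positive integers, and put $s_{n+1}=2$. The \emph{$s$-oruga graph} $G_s$ is the directed multigraph with vertices $v_{-1},v_0,\dots,v_n$ and the following edges: for each $i\in[1,n+1]$, $s_i-1$ parallel edges from $v_{-1}$ to $v_{n+1-i}$; and for each $i\in[1,n]$, two parallel edges from $v_{n-i}$ to $v_{n+1-i}$. For a vector $\mathbf a$ indexed by the vertices, a \emph{flow} with netflow $\mathbf a$ is a vector $(f_e)\in\mathbb R_{\ge 0}^{E(G_s)}$ such that $\sum_{e\text{ into }v}f_e+a_v=\sum_{e\text{ out of }v}f_e$ for every vertex $v$. Let $\mathcal F_{G_s}\subset\mathbb R^{E(G_s)}$ be the flow polytope consisting of all flows with netflow $(1,0,\dots,0,-1)$, and let $\mathcal F^{\mathbb Z}_{G_s}(\mathbf d)$ be the set of flows with all entries integers and netflow $\mathbf d=(0,0,s_n,s_{n-1},\dots,s_2,-\sum_{i=2}^n s_i)$ (vertices ordered $v_{-1},v_0,\dots,v_n$). A \emph{Stirling $s$-permutation} is a word containing exactly $s_a$ letters $a$ for each $a\in[n]$ (and no other letters) in which no letter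 $j$ occurs between two occurrences of a letter $i<j$. An \emph{$s$-decreasing tree} is a planar rooted tree with $n$ internal vertices labeled bijectively by $[n]$, in which the internal vertex labeled $i$ has $s_i+1$ children (ordered from left to right, each a leaf or an internal vertex) and every internal vertex that is a proper descendant of $i$ has a label smaller than $i$. The \emph{normalized volume} $\operatorname{vol}P$ of a $d$-dimensional lattice polytope $P\subset\mathbb R^E$ is $d!$ times its $d$-dimensional volume, measured in units of the covolume of the lattice of integer vectors parallel to the affine span of $P$. Then the set of Stirling $s$-permutations is in bijection with $\mathcal F^{\mathbb Z}_{G_s}(\mathbf d)$, and \[ \operatorname{vol}\mathcal F_{G_s}=\#\{s\text{-decreasing trees}\}=\#\{\text{Stirling }s\text{-permutations}\}=\prod_{i=1}^{n-1}\bigl(1+s_{n-i+1}+s_{n-i+2}+\cdots+s_n\bigr). \] -/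

import Mathlib

open Finset MeasureTheory
open scoped ENNReal Nat

namespace SOruga

/-! ### Flows on directed multigraphs -/

/-- A directed multigraph with vertex type `V` and edge type `E`. -/
structure MultiDigraph (V E : Type) where
  /-- The initial vertex of an edge. -/
  src : E → V
  /-- The final vertex of an edge. -/
  tgt : E → V

section Flows

variable {V E : Type} [DecidableEq V] [Fintype E]

/-- The polytope of flows `(f_e)_{e ∈ E}` on `G` with netflow `a`: nonnegative vectors such that at
each vertex the incoming flow plus the netflow equals the outgoing flow. -/
def flowPolytope (G : MultiDigraph V E) (a : V → ℝ) : Set (EuclideanSpace ℝ E) :=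
  {f | (∀ e, 0 ≤ f e) ∧
    ∀ v, (∑ e with G.tgt e = v, f e) + a v = ∑ e with G.src e = v, f e}

/-- The flows with netflow `a` all of whose entries are integers. -/
def integerFlows (G : MultiDigraph V E) (a : V → ℝ) : Set (EuclideanSpace ℝ E) :=
  {f ∈ flowPolytope G a | ∀ e, ∃ k : ℤ, f e = k}

end Flows

/-! ### Normalized volume -/

section Volume

variable {E : Type} [Fintype E]

/-- The lattice of integer vectors in the linear space parallel to the affine span of `P`. -/
noncomputable def directionLattice (P : Set (EuclideanSpace ℝ E)) :
    Submodule ℤ (vectorSpan ℝ P) :=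
  ZLattice.comap ℝ (Submodule.span ℤ (Set.range (EuclideanSpace.basisFun E ℝ)))
    (vectorSpan ℝ P).subtype

open scoped Classical in
/-- The normalized volume of a lattice polytope `P` in `ℝ^E`: if `d` is the dimension of `P`, this
is `d!` times the `d`-dimensional volume of `P`, measured in units of the covolume of the lattice of
integer vectors parallel to the affine span of `P` (so that a unimodular simplex has normalized
volume `1`). The polytope is translated by one of its points into the linear space parallel to its
affine span; the choice of this point is immaterial. -/
noncomputable def normalizedVolume (P : Set (EuclideanSpace ℝ E)) : ℝ≥0∞ :=
  if h : P.Nonempty then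
    ((Module.finrank ℝ (vectorSpan ℝ P))! : ℝ≥0∞) *
      (volume {v : vectorSpan ℝ P | (v : EuclideanSpace ℝ E) + h.some ∈ P} /
        ENNReal.ofReal (ZLattice.covolume (directionLattice P) volume))
  else 0

end Volume

section Composition

/-! Throughout, `s : Fin n → ℕ` stands for `(s_1, …, s_n)`, where `s_i` is `s` evaluated at the
element `i - 1` of `Fin n`; likewise the letter or label `i` is the element `i - 1` of `Fin n`. -/

variable {n : ℕ}

/-! ### The `s`-oruga graph -/

/-- The sequence `(s_1, …, s_n, s_{n+1})` with `s_{n+1} = 2`. -/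
def extend (s : Fin n → ℕ) : Fin (n + 1) → ℕ :=
  Fin.snoc (α := fun _ => ℕ) s 2

/-- The edges of the `s`-oruga graph: `Sum.inl ⟨i, j⟩` are the source-edges, `s_i - 1` of them for
each `i ∈ [1, n + 1]`; `Sum.inr (Sum.inl i)` are the bumps and `Sum.inr (Sum.inr i)` the dips, one
of each for every `i ∈ [1, n]`. -/
abbrev OrugaEdge (s : Fin n → ℕ) : Type :=
  (Σ i : Fin (n + 1), Fin (extend s i - 1)) ⊕ (Fin n ⊕ Fin n)

/-- The `s`-oruga graph. Its vertices are `v_{-1}, v_0, …, v_n`, with `v_j` represented by the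
element `j + 1` of `Fin (n + 2)`. For `i ∈ [1, n + 1]` the source-edges with index `i` go from
`v_{-1}` to `v_{n+1-i}`; for `i ∈ [1, n]` the bump and the dip with index `i` go from `v_{n-i}` to
`v_{n+1-i}`. -/
def oruga (s : Fin n → ℕ) : MultiDigraph (Fin (n + 2)) (OrugaEdge s) where
  src
    | Sum.inl _ => 0
    | Sum.inr (Sum.inl i) => ⟨n - i, by omega⟩
    | Sum.inr (Sum.inr i) => ⟨n - i, by omega⟩
  tgt
    | Sum.inl e => ⟨n + 1 - e.1, by omega⟩
    | Sum.inr (Sum.inl i) => ⟨n + 1 - i, by omega⟩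
    | Sum.inr (Sum.inr i) => ⟨n + 1 - i, by omega⟩

/-- The netflow `(1, 0, …, 0, -1)`. -/
def unitNetflow (n : ℕ) : Fin (n + 2) → ℝ :=
  fun v => if v = 0 then 1 else if v = Fin.last (n + 1) then -1 else 0

/-- The netflow `d = (0, 0, s_n, s_{n-1}, …, s_2, -∑_{i=2}^n s_i)`. -/
def dNetflow (s : Fin n → ℕ) : Fin (n + 2) → ℝ :=
  fun v =>
    if v = Fin.last (n + 1) then -∑ i ∈ {i : Fin n | 1 ≤ (i : ℕ)}, (s i : ℝ)
    else if h : 2 ≤ (v : ℕ) then (s ⟨n + 1 - v, by omega⟩ : ℝ)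
    else 0

/-! ### Stirling `s`-permutations -/

/-- The Stirling `s`-permutations: words with `s_a` occurrences of each letter `a` which avoid the
pattern `121`, i.e. have no (not necessarily contiguous) subword `i j i` with `i < j`. -/
def stirlingPerms (s : Fin n → ℕ) : Set (List (Fin n)) :=
  {w | (∀ a, w.count a = s a) ∧ ∀ i j : Fin n, i < j → ¬ [i, j, i].Sublist w}

/-! ### `s`-decreasing trees -/

/-- Planar rooted trees with internal vertices labeled in `[n]`, such that an internal vertex
labeled `i` has `s_i + 1` children, ordered from left to right. -/
inductive PlanarTree (s : Fin n → ℕ) : Type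
  | leaf : PlanarTree s
  | node (i : Fin n) (children : Fin (s i + 1) → PlanarTree s) : PlanarTree s

/-- The multiset of labels of the internal vertices of a tree. -/
def PlanarTree.labels {s : Fin n → ℕ} : PlanarTree s → Multiset (Fin n)
  | .leaf => 0
  | .node i c => i ::ₘ ∑ k, (c k).labels

/-- Every proper descendant of an internal vertex has a smaller label. -/
def PlanarTree.IsDecreasing {s : Fin n → ℕ} : PlanarTree s → Prop
  | .leaf => True
  | .node i c => ∀ k, (∀ j ∈ (c k).labels, j < i) ∧ (c k).IsDecreasing

/-- The `s`-decreasing trees: each element of `[n]` labels exactly one internal vertex, and labels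
decrease from a vertex to its descendants. -/
def decreasingTrees (s : Fin n → ℕ) : Set (PlanarTree s) :=
  {T | T.labels = (Finset.univ : Finset (Fin n)).val ∧ T.IsDecreasing}

end Composition

end SOruga

/-!
All four quantities are computed independently and turn out to be the product of the numbers
`1 + s_{k+1} + ⋯ + s_n` over `k ∈ [1, n]`, where the factor for `k = n` is `1`.

*Words.* In a Stirling permutation the copies of the least letter are consecutive. Removing this
block leaves a Stirling permutation on the remaining letters, and the block can be put back at any
of the `1 + s_{k+1} + ⋯ + s_n` positions of a word on the letters `> k` (`tailPerms_eq_image`,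
`injOn_insertBlock`).

*Trees.* Likewise, the children of the vertex with the least label are leaves. Turning this vertex
into a leaf gives a decreasing tree on the remaining labels, and conversely the vertex may be
grafted to any leaf of such a tree, which has `1 + s_{k+1} + ⋯ + s_n` leaves (`tailTreesEquiv`,
`PlanarTree.card_leaf`).

*Integer flows.* The netflow `d` forces the flow on the source-edges to vanish, and by conservation
the bump and the dip with index `k` carry a total of `s_{k+1} + ⋯ + s_n`
(`mem_flowPolytope_dNetflow_iff`). So the flow on the bump can be chosen freely among
`1 + s_{k+1} + ⋯ + s_n` values (`bumpEquiv`).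

*Volume.* A flow with unit netflow is determined by its values on the bumps and on the source-edges
other than the one entering `v_0`, through formulas with integer coefficients. The coordinates are
therefore unimodular, and the normalized volume is `d!` times the Lebesgue measure of the region
`chainRegion` of admissible coordinates (`normalizedVolume_affine_image`,
`flowPolytope_eq_image`). This measure is an iterated integral: with `R_k` denoting the amount of
flow that has entered `v_0, …, v_{n-k}`, integrating out the bump with index `k` multiplies the
integrand by `R_k`, as the flow on it ranges over `[0, R_k]`, and turns `R_k ^ p / p!` into
`(p + 1) R_k ^ (p + 1) / (p + 1)!`; integrating out a source-edge entering `v_{n+1-k}` raises the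
exponent of the divided power by one. At the bump with index `k` the exponent is
`p = s_{k+1} + ⋯ + s_n`, which accounts for the factors (`lmarginal_chainIntegrand_levels`,
`volume_chainRegion`).
-/

namespace SOruga

/-! ### Stirling permutations -/

section Words

variable {n : ℕ}

/-- The sum of the entries of `s` at positions `≥ m` (counted from `0`). -/
def tailSum (s : Fin n → ℕ) (m : ℕ) : ℕ := ∑ r with m ≤ (r : Fin n).val, s r

theorem tailSum_succ (s : Fin n → ℕ) (k : Fin n) :
    tailSum s k = s k + tailSum s (k + 1) := by
  have : ({r | k.val ≤ r.val} : Finset (Fin n)) =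
      insert k ({r | k.val + 1 ≤ r.val} : Finset (Fin n)) := by
    ext r; simp [Fin.ext_iff]; omega
  rw [tailSum, this, Finset.sum_insert (by simp), tailSum]

/-- The words in the letters `≥ m` (counted from `0`) that satisfy the conditions on a Stirling
permutation for these letters. -/
def tailPerms (s : Fin n → ℕ) (m : ℕ) : Set (List (Fin n)) :=
  {w | (∀ a : Fin n, w.count a = if m ≤ a.val then s a else 0) ∧
    ∀ i j : Fin n, i < j → ¬ [i, j, i].Sublist w}

theorem length_of_mem_tailPerms {s : Fin n → ℕ} {m : ℕ} {w : List (Fin n)}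
    (hw : w ∈ tailPerms s m) : w.length = tailSum s m := by
  rw [tailSum, Finset.sum_filter, ← Finset.sum_congr rfl fun a _ => hw.1 a]
  have := Multiset.sum_count_eq_card (s := univ) (m := (w : Multiset (Fin n))) (by simp)
  simpa using this.symm

theorem le_of_mem_tailPerms {s : Fin n → ℕ} {m : ℕ} {w : List (Fin n)}
    (hw : w ∈ tailPerms s m) {a : Fin n} (ha : a ∈ w) : m ≤ a.val := by
  by_contra h
  have := hw.1 a
  rw [if_neg h] at this
  exact List.count_eq_zero.1 this ha

/-- The word obtained by inserting `c` consecutive letters `a` before position `p` of `w`. -/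
def insertBlock (a : Fin n) (c : ℕ) (x : List (Fin n) × ℕ) : List (Fin n) :=
  x.1.take x.2 ++ (List.replicate c a ++ x.1.drop x.2)

/-- In a word without a larger letter between two copies of its least letter `a`, the copies of `a`
are consecutive. -/
theorem exists_eq_append_replicate_append (a : Fin n) (w : List (Fin n)) (h1 : ∀ b ∈ w, a ≤ b)
    (h2 : ∀ j, a < j → ¬ [a, j, a].Sublist w) :
    ∃ u v, w = u ++ (List.replicate (w.count a) a ++ v) ∧ a ∉ u ∧ a ∉ v := by
  induction w with
  | nil => exact ⟨[], [], by simp⟩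
  | cons x w ih =>
    obtain ⟨u, v, hw, hu, hv⟩ := ih (fun b hb => h1 b (List.mem_cons_of_mem _ hb))
      (fun j hj h => h2 j hj (h.trans (List.sublist_cons_self x w)))
    by_cases hx : x = a
    · subst hx
      rw [List.count_cons_self]
      by_cases hc : w.count x = 0
      · refine ⟨[], w, ?_, by simp, List.count_eq_zero.1 hc⟩
        simp [hc]
      · -- A letter of `u` would lie between the first copy of `x` and the next one.
        have hu' : u = [] := by
          by_contra hne
          obtain ⟨j, u', rfl⟩ := List.exists_cons_of_ne_nil hne
          have hjw : j ∈ w := by rw [hw]; simp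
          have hj : x < j := lt_of_le_of_ne (h1 j (List.mem_cons_of_mem _ hjw))
            fun h => hu (by simp [h])
          refine h2 j hj ?_
          rw [hw, List.cons_sublist_cons, List.cons_append, List.cons_sublist_cons,
            List.singleton_sublist]
          simp [hc]
        subst hu'
        refine ⟨[], v, ?_, by simp, hv⟩
        rw [List.replicate_succ]
        simpa using hw
    · refine ⟨x :: u, v, ?_, ?_, hv⟩
      · rw [List.count_cons_of_ne hx, List.cons_append, ← hw]
      · simp [hu, Ne.symm hx]

/-- Inserting a block of copies of a letter less than all letters of `u ++ v` does not create a
pattern `i j i` with `i < j`. -/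
theorem not_sublist_insertBlock {a : Fin n} {u v : List (Fin n)} (c : ℕ)
    (ha : ∀ b ∈ u ++ v, a < b) (h : ∀ i j : Fin n, i < j → ¬ [i, j, i].Sublist (u ++ v))
    (i j : Fin n) (hij : i < j) :
    ¬ [i, j, i].Sublist (u ++ (List.replicate c a ++ v)) := by
  intro hs
  have hi : i ∈ u ++ (List.replicate c a ++ v) := hs.subset (by simp)
  have hai : a ≤ i := by
    simp only [List.mem_append, List.mem_replicate] at hi ha
    rcases hi with hi | hi | hi
    · exact (ha i (.inl hi)).le
    · exact hi.2.ge
    · exact (ha i (.inr hi)).le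
  have hfu : (u ++ v).filter (· ≠ a) = u ++ v :=
    List.filter_eq_self.2 fun b hb => by simpa using (ha b hb).ne'
  -- If `i ≠ a`, deleting the letters `a` gives the pattern in `u ++ v`; if `i = a`, both copies of
  -- `i`, and hence `j`, lie in the block.
  rcases hai.lt_or_eq with hai | rfl
  · have h3 := hs.filter (· ≠ a)
    have h4 : (List.replicate c a).filter (· ≠ a) = [] :=
      List.filter_eq_nil_iff.2 fun b hb => by simp [List.eq_of_mem_replicate hb]
    rw [List.filter_append, List.filter_append, h4, List.nil_append, ← List.filter_append,
      hfu, List.filter_eq_self.2] at h3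
    · exact h i j hij h3
    · simp [hai.ne', (hai.trans hij).ne']
  · have hau : a ∉ u := fun h => (ha a (by simp [h])).false
    have hav : a ∉ v := fun h => (ha a (by simp [h])).false
    obtain ⟨l₁, l₂, h5, h6, h7⟩ := List.sublist_append_iff.1 hs
    cases l₁ with
    | cons b l =>
      simp at h5
      exact hau (h6.subset (by simp [h5.1]))
    | nil =>
      rw [List.nil_append] at h5
      subst h5
      have h8 := h7.reverse
      rw [List.reverse_append] at h8
      obtain ⟨l₁, l₂, h5, h6, h7⟩ := List.sublist_append_iff.1 h8
      cases l₁ with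
      | cons b l =>
        simp at h5
        exact hav (by simpa using h6.subset (show a ∈ b :: l by simp [h5.1]))
      | nil =>
        rw [List.nil_append] at h5
        subst h5
        have : j ∈ (List.replicate c a).reverse := h7.subset (by simp)
        simp at this
        exact hij.ne' this.2

theorem tailPerms_eq_image (s : Fin n → ℕ) (k : Fin n) :
    tailPerms s k = insertBlock k (s k) ''
      (tailPerms s (k + 1) ×ˢ Set.Iio (tailSum s (k + 1) + 1)) := by
  ext w
  constructor
  · intro hw
    obtain ⟨u, v, huv, hu, hv⟩ := exists_eq_append_replicate_append k w
      (fun b hb => le_of_mem_tailPerms hw hb) (fun j hj => hw.2 k j hj)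
    rw [hw.1 k, if_pos le_rfl] at huv
    have hmem : u ++ v ∈ tailPerms s (k + 1) := by
      refine ⟨fun a => ?_, fun i j hij h => hw.2 i j hij (h.trans ?_)⟩
      · by_cases hak : a = k
        · subst hak
          simp [List.count_eq_zero.2 hu, List.count_eq_zero.2 hv]
        · have h1 := hw.1 a
          have h2 : k.val ≤ a.val ↔ k.val + 1 ≤ a.val := by
            have : a.val ≠ k.val := fun h => hak (Fin.ext h)
            omega
          simp only [huv, List.count_append, List.count_replicate, beq_iff_eq, Ne.symm hak,
            if_false, zero_add, h2] at h1
          rw [List.count_append, h1]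
      · rw [huv]
        exact (List.Sublist.refl u).append (List.sublist_append_right _ _)
    refine ⟨(u ++ v, u.length), ⟨hmem, ?_⟩, ?_⟩
    · have := length_of_mem_tailPerms hmem
      rw [List.length_append] at this
      simp only [Set.mem_Iio]
      omega
    · simp [insertBlock, huv]
  · rintro ⟨⟨w, p⟩, ⟨hw, -⟩, rfl⟩
    have hkw : ∀ b ∈ w.take p ++ w.drop p, k < b := fun b hb => by
      rw [List.take_append_drop] at hb
      exact Nat.lt_of_succ_le (le_of_mem_tailPerms hw hb)
    refine ⟨fun a => ?_, not_sublist_insertBlock _ hkw ?_⟩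
    · have h1 := hw.1 a
      rw [← List.take_append_drop p w, List.count_append] at h1
      rw [insertBlock, List.count_append, List.count_append, List.count_replicate]
      by_cases hak : a = k
      · subst hak
        simp at h1 ⊢
        omega
      · have h2 : k.val ≤ a.val ↔ k.val + 1 ≤ a.val := by
          have : a.val ≠ k.val := fun h => hak (Fin.ext h)
          omega
        simp only [h2, ← h1, beq_iff_eq, Ne.symm hak, if_false, zero_add]
    · rw [List.take_append_drop]
      exact hw.2

/-- The word and the position are recovered by deleting all letters `k` and by looking up the first
of them. -/
theorem injOn_insertBlock (s : Fin n → ℕ) (k : Fin n) (hk : 0 < s k) :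
    Set.InjOn (insertBlock k (s k))
      (tailPerms s (k + 1) ×ˢ Set.Iio (tailSum s (k + 1) + 1)) := by
  have hkey : ∀ x ∈ tailPerms s (k + 1) ×ˢ Set.Iio (tailSum s (k + 1) + 1),
      (insertBlock k (s k) x).filter (· ≠ k) = x.1 ∧ (insertBlock k (s k) x).idxOf k = x.2 := by
    rintro ⟨w, p⟩ ⟨hw, hp⟩
    have hkw : k ∉ w := fun h => by
      have := le_of_mem_tailPerms hw h
      omega
    have hp' : p ≤ w.length := by
      rw [length_of_mem_tailPerms hw]
      exact Nat.lt_succ_iff.1 hp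
    constructor
    · have h4 : (List.replicate (s k) k).filter (· ≠ k) = [] :=
        List.filter_eq_nil_iff.2 fun b hb => by simp [List.eq_of_mem_replicate hb]
      rw [insertBlock, List.filter_append, List.filter_append, h4, List.nil_append,
        ← List.filter_append, List.take_append_drop, List.filter_eq_self]
      intro b hb
      have : b ≠ k := fun h => hkw (h ▸ hb)
      simpa using this
    · rw [insertBlock, List.idxOf_append_of_notMem (fun h => hkw (List.mem_of_mem_take h)),
        List.length_take, min_eq_left hp']
      obtain ⟨c, hc⟩ := Nat.exists_eq_succ_of_ne_zero hk.ne'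
      simp [hc, List.replicate_succ]
  intro x hx y hy hxy
  obtain ⟨h1, h2⟩ := hkey x hx
  obtain ⟨h3, h4⟩ := hkey y hy
  rw [hxy] at h1 h2
  exact Prod.ext (h1.symm.trans h3) (h2.symm.trans h4)

theorem ncard_tailPerms (s : Fin n → ℕ) (hs : ∀ i, 0 < s i) (m : ℕ) (hm : m ≤ n) :
    (tailPerms s m).ncard = ∏ k ∈ Ico m n, (1 + tailSum s (k + 1)) := by
  induction hm using Nat.decreasingInduction with
  | self =>
    have : tailPerms s n = {[]} := by
      ext w
      rw [Set.mem_singleton_iff]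
      constructor
      · intro hw
        refine List.eq_nil_iff_forall_not_mem.2 fun a ha => ?_
        have := le_of_mem_tailPerms hw ha
        omega
      · rintro rfl
        exact ⟨fun a => by simp, by simp⟩
    simp [this]
  | of_succ m hm ih =>
    rw [tailPerms_eq_image s ⟨m, hm⟩, (injOn_insertBlock s ⟨m, hm⟩ (hs _)).ncard_image,
      Set.ncard_prod, ih, Set.ncard_eq_toFinset_card', Set.toFinset_Iio, Nat.card_Iio,
      Finset.prod_eq_prod_Ico_succ_bot hm, mul_comm, add_comm 1]

theorem ncard_stirlingPerms (s : Fin n → ℕ) (hs : ∀ i, 0 < s i) :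
    (stirlingPerms s).ncard = ∏ k ∈ range n, (1 + tailSum s (k + 1)) := by
  rw [Finset.range_eq_Ico, ← ncard_tailPerms s hs 0 (Nat.zero_le n)]
  simp [stirlingPerms, tailPerms]

end Words

/-! ### Decreasing trees -/

section Trees

variable {n : ℕ} {s : Fin n → ℕ}

namespace PlanarTree

/-- The leaves of a tree, each given by the path leading to it from the root. -/
def Leaf : PlanarTree s → Type
  | .leaf => Unit
  | .node i c => Σ k : Fin (s i + 1), (c k).Leaf

instance instFintypeLeaf : (T : PlanarTree s) → Fintype T.Leaf
  | .leaf => inferInstanceAs (Fintype Unit)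
  | .node i c =>
    letI := fun k => instFintypeLeaf (c k)
    inferInstanceAs (Fintype (Σ k : Fin (s i + 1), (c k).Leaf))

theorem card_leaf (T : PlanarTree s) : Fintype.card T.Leaf = 1 + (T.labels.map s).sum := by
  induction T with
  | leaf => rfl
  | node i c ih =>
    have h1 : Fintype.card (node i c).Leaf = ∑ k, Fintype.card (c k).Leaf :=
      Fintype.card_sigma
    have h2 : ((∑ k, (c k).labels).map s).sum = ∑ k, ((c k).labels.map s).sum :=
      map_sum (Multiset.sumAddMonoidHom.comp (Multiset.mapAddMonoidHom s)) _ _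
    rw [h1, labels, Multiset.map_cons, Multiset.sum_cons, h2, Finset.sum_congr rfl fun k _ => ih k,
      Finset.sum_add_distrib]
    simp
    ring

/-- The tree obtained by replacing a leaf with an internal vertex labeled `a`, all of whose children
are leaves. -/
def graft (a : Fin n) : (T : PlanarTree s) → T.Leaf → PlanarTree s
  | .leaf, _ => .node a fun _ => .leaf
  | .node i c, ⟨k, l⟩ => .node i (Function.update c k ((c k).graft a l))

theorem mem_labels_node {i a : Fin n} {c : Fin (s i + 1) → PlanarTree s} :
    a ∈ (node i c).labels ↔ a = i ∨ ∃ k, a ∈ (c k).labels := by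
  simp [labels, Multiset.mem_sum]

theorem labels_graft (a : Fin n) (T : PlanarTree s) (l : T.Leaf) :
    (T.graft a l).labels = a ::ₘ T.labels := by
  induction T with
  | leaf => simp [graft, labels]
  | node i c ih =>
    obtain ⟨k, l⟩ := l
    rw [graft, labels, labels, Multiset.cons_swap,
      ← Finset.add_sum_erase univ _ (Finset.mem_univ k),
      ← Finset.add_sum_erase univ (fun k => (c k).labels) (Finset.mem_univ k),
      Function.update_self, ih, Multiset.cons_add]
    congr 3
    refine Finset.sum_congr rfl fun j hj => ?_
    rw [Function.update_of_ne (Finset.ne_of_mem_erase hj)]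

theorem isDecreasing_graft {a : Fin n} {T : PlanarTree s} (l : T.Leaf) (hT : T.IsDecreasing)
    (ha : ∀ b ∈ T.labels, a < b) : (T.graft a l).IsDecreasing := by
  induction T with
  | leaf => simp [graft, IsDecreasing, labels]
  | node i c ih =>
    obtain ⟨k, l⟩ := l
    intro j
    by_cases hj : j = k
    · subst hj
      rw [Function.update_self, labels_graft]
      refine ⟨fun b hb => ?_, ih j l (hT j).2 fun b hb => ha b (mem_labels_node.2 (.inr ⟨j, hb⟩))⟩
      rcases Multiset.mem_cons.1 hb with rfl | hb
      · exact ha i (mem_labels_node.2 (.inl rfl))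
      · exact (hT j).1 b hb
    · rw [Function.update_of_ne hj]
      exact hT j

/-- The tree obtained by replacing the subtrees rooted at vertices labeled `a` with leaves. -/
def prune (a : Fin n) : PlanarTree s → PlanarTree s
  | .leaf => .leaf
  | .node i c => if i = a then .leaf else .node i fun k => (c k).prune a

theorem prune_eq_self {a : Fin n} {T : PlanarTree s} (ha : a ∉ T.labels) : T.prune a = T := by
  induction T with
  | leaf => rfl
  | node i c ih =>
    rw [mem_labels_node, not_or, not_exists] at ha
    rw [prune, if_neg (Ne.symm ha.1)]
    congr 1
    ext1 k
    exact ih k (ha.2 k)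

theorem prune_graft {a : Fin n} {T : PlanarTree s} (l : T.Leaf) (ha : a ∉ T.labels) :
    (T.graft a l).prune a = T := by
  induction T with
  | leaf => simp [graft, prune]
  | node i c ih =>
    obtain ⟨k, l⟩ := l
    rw [mem_labels_node, not_or, not_exists] at ha
    rw [graft, prune, if_neg (Ne.symm ha.1)]
    congr 1
    ext1 j
    by_cases hj : j = k
    · subst hj
      rw [Function.update_self, ih j l (ha.2 j)]
    · rw [Function.update_of_ne hj, prune_eq_self (ha.2 j)]

theorem graft_injective {a : Fin n} {T : PlanarTree s} (ha : a ∉ T.labels) :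
    Function.Injective (T.graft a) := by
  induction T with
  | leaf => exact fun _ _ _ => rfl
  | node i c ih =>
    rintro ⟨k, l⟩ ⟨k', l'⟩ h
    rw [mem_labels_node, not_or, not_exists] at ha
    rw [graft, graft, node.injEq] at h
    have h2 := congrFun (eq_of_heq h.2) k
    rw [Function.update_self] at h2
    by_cases hk : k = k'
    · subst hk
      rw [Function.update_self] at h2
      rw [ih k (ha.2 k) h2]
    · rw [Function.update_of_ne hk] at h2
      refine absurd ?_ (ha.2 k)
      rw [← h2, labels_graft]
      exact Multiset.mem_cons_self _ _

/-- In a decreasing tree, the children of the vertex with the least label `a` are leaves, so that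
the tree arises by grafting `a` to a tree without this label. -/
theorem exists_graft_eq {a : Fin n} {T : PlanarTree s} (hT : T.IsDecreasing)
    (hd : T.labels.Nodup) (ha : a ∈ T.labels) (hle : ∀ b ∈ T.labels, a ≤ b) :
    ∃ (T' : PlanarTree s) (l : T'.Leaf), T'.graft a l = T ∧ T'.IsDecreasing := by
  induction T with
  | leaf => simp [labels] at ha
  | node i c ih =>
    rcases mem_labels_node.1 ha with rfl | ⟨k, hk⟩
    · refine ⟨.leaf, (), ?_, trivial⟩
      change node a (fun _ => .leaf) = node a c
      congr 1
      ext1 k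
      cases hc : c k with
      | leaf => rfl
      | node j d =>
        have hj : j ∈ (c k).labels := by rw [hc]; exact Multiset.mem_cons_self _ _
        exact absurd ((hT k).1 j hj) (hle j (mem_labels_node.2 (.inr ⟨k, hj⟩))).not_gt
    · have hd' : (c k).labels.Nodup := by
        refine Multiset.nodup_of_le ?_ hd
        exact (Finset.single_le_sum_of_canonicallyOrdered (f := fun k => (c k).labels)
          (Finset.mem_univ k)).trans (Multiset.le_cons_self _ _)
      obtain ⟨T', l, h1, h2⟩ := ih k (hT k).2 hd' hk
        fun b hb => hle b (mem_labels_node.2 (.inr ⟨k, hb⟩))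
      refine ⟨.node i (Function.update c k T'), ⟨k, cast (by rw [Function.update_self]) l⟩, ?_, ?_⟩
      · rw [graft]
        congr 1
        rw [Function.update_idem, Function.update_eq_iff]
        refine ⟨?_, fun _ _ => rfl⟩
        rw [← h1]
        congr 1
        · rw [Function.update_self]
        · exact cast_heq _ _
      · intro j
        by_cases hj : j = k
        · subst hj
          rw [Function.update_self]
          refine ⟨fun b hb => (hT j).1 b ?_, h2⟩
          rw [← h1, labels_graft]
          exact Multiset.mem_cons_of_mem hb
        · rw [Function.update_of_ne hj]
          exact hT j

end PlanarTree

/-- The decreasing trees in which precisely the labels `≥ m` (counted from `0`) are used, each of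
them once. -/
def tailTrees (s : Fin n → ℕ) (m : ℕ) : Set (PlanarTree s) :=
  {T | T.labels = ({i | m ≤ i.val} : Finset (Fin n)).val ∧ T.IsDecreasing}

theorem mem_labels_of_mem_tailTrees {m : ℕ} {T : PlanarTree s} (hT : T ∈ tailTrees s m)
    {a : Fin n} : a ∈ T.labels ↔ m ≤ a.val := by
  rw [hT.1]
  simp

theorem val_filter_le (k : Fin n) : ({i | k.val ≤ i.val} : Finset (Fin n)).val =
    k ::ₘ ({i | k.val + 1 ≤ i.val} : Finset (Fin n)).val := by
  rw [← Finset.insert_val_of_notMem (by simp)]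
  congr 1
  ext r; simp [Fin.ext_iff]; omega

/-- Grafting the label `k` to the decreasing trees on the labels `> k`. -/
noncomputable def tailTreesEquiv (s : Fin n → ℕ) (k : Fin n) :
    (Σ T : tailTrees s (k + 1), T.1.Leaf) ≃ tailTrees s k :=
  Equiv.ofBijective
    (fun x => ⟨x.1.1.graft k x.2, by
      rw [PlanarTree.labels_graft, x.1.2.1, val_filter_le],
      PlanarTree.isDecreasing_graft _ x.1.2.2 fun b hb =>
        (mem_labels_of_mem_tailTrees x.1.2).1 hb⟩) <| by
    constructor
    · rintro ⟨⟨T, hT⟩, l⟩ ⟨⟨T', hT'⟩, l'⟩ h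
      have hk : ∀ {T}, T ∈ tailTrees s (k + 1) → k ∉ T.labels := fun hT h => by
        have := (mem_labels_of_mem_tailTrees hT).1 h
        omega
      have h1 : T.graft k l = T'.graft k l' := congrArg Subtype.val h
      have h2 : T = T' := (PlanarTree.prune_graft l (hk hT)).symm.trans
        ((congrArg (PlanarTree.prune k) h1).trans (PlanarTree.prune_graft l' (hk hT')))
      subst h2
      rw [PlanarTree.graft_injective (hk hT) h1]
    · rintro ⟨T, hT⟩
      obtain ⟨T', l, rfl, h2⟩ := PlanarTree.exists_graft_eq hT.2 (by rw [hT.1]; exact Finset.nodup _)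
        ((mem_labels_of_mem_tailTrees hT).2 le_rfl) fun b hb => (mem_labels_of_mem_tailTrees hT).1 hb
      refine ⟨⟨⟨T', ?_, h2⟩, l⟩, rfl⟩
      have := hT.1
      rwa [PlanarTree.labels_graft, val_filter_le, Multiset.cons_inj_right] at this

theorem finite_and_card_tailTrees (s : Fin n → ℕ) (m : ℕ) (hm : m ≤ n) :
    Finite (tailTrees s m) ∧
      Nat.card (tailTrees s m) = ∏ k ∈ Ico m n, (1 + tailSum s (k + 1)) := by
  induction hm using Nat.decreasingInduction with
  | self =>
    have h1 : ({i | n ≤ i.val} : Finset (Fin n)) = ∅ :=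
      Finset.filter_eq_empty_iff.2 fun i _ => not_le.2 i.2
    have : tailTrees s n = {.leaf} := by
      ext T
      cases T with
      | leaf => simp [tailTrees, h1, PlanarTree.labels, PlanarTree.IsDecreasing]
      | node i c => simp [tailTrees, h1, PlanarTree.labels]
    rw [this]
    simp
    infer_instance
  | of_succ m hm ih =>
    obtain ⟨hfin, hcard⟩ := ih
    have e := tailTreesEquiv s ⟨m, hm⟩
    have := Fintype.ofFinite (tailTrees s (m + 1))
    refine ⟨Finite.of_equiv _ e, ?_⟩
    rw [← Nat.card_congr e, Nat.card_sigma, Finset.prod_eq_prod_Ico_succ_bot hm, ← hcard,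
      Nat.card_eq_fintype_card, mul_comm, ← smul_eq_mul, ← Finset.card_univ, ← Finset.sum_const]
    refine Finset.sum_congr rfl fun T _ => ?_
    rw [Nat.card_eq_fintype_card, PlanarTree.card_leaf, T.2.1]
    rfl

theorem ncard_decreasingTrees (s : Fin n → ℕ) :
    (decreasingTrees s).ncard = ∏ k ∈ range n, (1 + tailSum s (k + 1)) := by
  rw [Finset.range_eq_Ico, ← (finite_and_card_tailTrees s 0 (Nat.zero_le n)).2,
    ← Nat.card_coe_set_eq]
  simp [decreasingTrees, tailTrees]

end Trees

/-! ### Normalized volume in unimodular coordinates -/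

section Lattice

theorem vectorSpan_affine_image {ι E : Type} [Fintype ι] [DecidableEq ι] [Fintype E]
    (L : (ι → ℝ) →ₗ[ℝ] EuclideanSpace ℝ E) (p : EuclideanSpace ℝ E) {Q : Set (ι → ℝ)}
    (h0 : 0 ∈ Q) (h1 : ∀ i, Pi.single i 1 ∈ Q) :
    vectorSpan ℝ ((fun x => L x + p) '' Q) = LinearMap.range L := by
  apply le_antisymm
  · rw [vectorSpan, Submodule.span_le]
    rintro _ ⟨_, ⟨x, _, rfl⟩, _, ⟨y, _, rfl⟩, rfl⟩
    exact ⟨x - y, by simp [vsub_eq_sub]⟩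
  · rw [LinearMap.range_eq_map, ← (Pi.basisFun ℝ ι).span_eq, Submodule.map_span, Submodule.span_le]
    rintro _ ⟨_, ⟨i, rfl⟩, rfl⟩
    have := vsub_mem_vectorSpan ℝ (Set.mem_image_of_mem (fun x => L x + p) (h1 i))
      (Set.mem_image_of_mem (fun x => L x + p) h0)
    simpa [vsub_eq_sub] using this

theorem mem_span_basisFun_iff {E : Type} [Fintype E] (v : EuclideanSpace ℝ E) :
    v ∈ Submodule.span ℤ (Set.range (EuclideanSpace.basisFun E ℝ)) ↔
      ∀ e, ∃ k : ℤ, v e = k := by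
  have := (EuclideanSpace.basisFun E ℝ).toBasis.mem_span_iff_repr_mem ℤ v
  rw [OrthonormalBasis.coe_toBasis] at this
  rw [this]
  simp [eq_comm]

/-- If `Q` contains the origin and the standard basis vectors and `L` is an integral linear map
some coordinates of which recover its argument, then `L` identifies `ℤ^ι` with the lattice of
integer vectors in its range. Hence the normalized volume of a translate of `L '' Q` is the volume
of `Q` multiplied by the factorial of the dimension. -/
theorem normalizedVolume_affine_image {ι E : Type} [Fintype ι] [DecidableEq ι] [Fintype E]
    (L : (ι → ℝ) →ₗ[ℝ] EuclideanSpace ℝ E) (g : ι → E) (hg : ∀ x i, L x (g i) = x i)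
    (hL : ∀ i e, ∃ k : ℤ, L (Pi.single i 1) e = k) (p : EuclideanSpace ℝ E) {Q : Set (ι → ℝ)}
    (h0 : 0 ∈ Q) (h1 : ∀ i, Pi.single i 1 ∈ Q) (hQ : MeasurableSet Q) :
    normalizedVolume ((fun x => L x + p) '' Q) = (Fintype.card ι)! * volume Q := by
  have hinj : Function.Injective L := fun x y h => by
    ext i; rw [← hg x, ← hg y, h]
  have hne : ((fun x => L x + p) '' Q).Nonempty := ⟨_, 0, h0, rfl⟩
  rw [normalizedVolume, dif_pos hne]
  obtain ⟨x₀, hx₀, hp⟩ := hne.some_mem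
  rw [← hp]
  have hW := vectorSpan_affine_image L p h0 h1
  unfold directionLattice
  let Φ : (ι → ℝ) ≃ₗ[ℝ] vectorSpan ℝ ((fun x => L x + p) '' Q) :=
    (LinearEquiv.ofInjective L hinj).trans (LinearEquiv.ofEq _ _ hW.symm)
  -- The images of the standard basis vectors form a real basis of the direction space, and an
  -- integral basis of its lattice.
  let b : Module.Basis ι ℝ (vectorSpan ℝ ((fun x => L x + p) '' Q)) := (Pi.basisFun ℝ ι).map Φ
  have hb : ∀ x, b.equivFun (Φ x) = x := fun x => by
    ext i
    simp [b]
  have hlat : ZLattice.comap ℝ (Submodule.span ℤ (Set.range (EuclideanSpace.basisFun E ℝ)))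
      (vectorSpan ℝ ((fun x => L x + p) '' Q)).subtype = Submodule.span ℤ (Set.range b) := by
    ext v
    obtain ⟨x, rfl⟩ := Φ.surjective v
    have h2 : Φ x ∈ ZLattice.comap ℝ
        (Submodule.span ℤ (Set.range (EuclideanSpace.basisFun E ℝ)))
        (vectorSpan ℝ ((fun x => L x + p) '' Q)).subtype ↔ ∀ e, ∃ k : ℤ, L x e = k :=
      mem_span_basisFun_iff (L x)
    rw [h2, b.mem_span_iff_repr_mem ℤ]
    have h3 : ∀ i, b.repr (Φ x) i = x i := fun i => congrFun (hb x) i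
    simp only [h3, Set.mem_range, algebraMap_int_eq, eq_intCast]
    constructor
    · intro h i
      obtain ⟨k, hk⟩ := h (g i)
      exact ⟨k, by rw [← hk, hg]⟩
    · intro h e
      choose k hk using h
      choose l hl using hL
      refine ⟨∑ i, k i * l i e, ?_⟩
      have hx : x = ∑ i, (k i : ℝ) • (Pi.single i 1 : ι → ℝ) := by
        ext j
        simp [Finset.sum_apply, Pi.single_apply, hk]
      rw [hx]
      simp [hl]
  rw [hlat, ← Φ.finrank_eq, Module.finrank_fintype_fun_eq_card]
  have hbz : (b.restrictScalars ℤ).ofZLatticeBasis ℝ (Submodule.span ℤ (Set.range b)) = b := by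
    apply Module.Basis.eq_of_apply_eq
    intro i
    rw [Module.Basis.ofZLatticeBasis_apply, Module.Basis.restrictScalars_apply]
  have himg : b.equivFun '' {v : vectorSpan ℝ ((fun x => L x + p) '' Q) |
      (v : EuclideanSpace ℝ E) + (L x₀ + p) ∈ (fun x => L x + p) '' Q} = (fun x => x + x₀) ⁻¹' Q := by
    ext x
    constructor
    · rintro ⟨v, ⟨y, hy, hyv⟩, rfl⟩
      obtain ⟨z, rfl⟩ := Φ.surjective v
      have hz : L y = L (z + x₀) := by
        have : L y + p = L z + (L x₀ + p) := hyv
        rw [map_add]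
        exact add_right_cancel (this.trans (add_assoc _ _ _).symm)
      rw [hb]
      rw [Set.mem_preimage, ← hinj hz]
      exact hy
    · intro hx
      refine ⟨Φ x, ⟨x + x₀, hx, ?_⟩, hb x⟩
      change L (x + x₀) + p = L x + (L x₀ + p)
      rw [map_add, add_assoc]
  have hmeas : MeasurableSet {v : vectorSpan ℝ ((fun x => L x + p) '' Q) |
      (v : EuclideanSpace ℝ E) + (L x₀ + p) ∈ (fun x => L x + p) '' Q} := by
    have h4 : MeasurableSet (b.equivFunL ⁻¹' ((fun x => x + x₀) ⁻¹' Q)) :=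
      b.equivFunL.continuous.measurable ((measurable_add_const x₀) hQ)
    convert h4 using 1
    rw [← himg]
    exact (Set.preimage_image_eq _ b.equivFun.injective).symm
  have := ZLattice.volume_image_eq_volume_div_covolume' (Submodule.span ℤ (Set.range b))
    (b.restrictScalars ℤ) hmeas.nullMeasurableSet
  rw [hbz, himg, measure_preimage_add_right] at this
  rw [this]

end Lattice

/-! ### The volume of the region of coordinates -/

section Region

/-- The divided power `t ^ p / p!`, cut off to `0` at negative `t`; also for `p = 0`, so that
`dividedPow 0` is the indicator function of `[0, ∞)`. -/
noncomputable def dividedPow (p : ℕ) (t : ℝ) : ℝ≥0∞ :=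
  if 0 ≤ t then ENNReal.ofReal (t ^ p / p !) else 0

theorem measurable_dividedPow (p : ℕ) : Measurable (dividedPow p) :=
  Measurable.ite measurableSet_Ici (by fun_prop) measurable_const

theorem lintegral_dividedPow_sub (p : ℕ) (t : ℝ) :
    ∫⁻ y, (if 0 ≤ y then dividedPow p (t - y) else 0) = dividedPow (p + 1) t := by
  have h1 : (fun y => if 0 ≤ y then dividedPow p (t - y) else 0) =
      (Set.Icc 0 t).indicator (fun y => ENNReal.ofReal ((t - y) ^ p / p !)) := by
    ext y
    simp only [dividedPow, Set.indicator, Set.mem_Icc, sub_nonneg]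
    split_ifs <;> simp_all
  rw [h1, lintegral_indicator measurableSet_Icc]
  rcases lt_or_ge t 0 with ht | ht
  · rw [Set.Icc_eq_empty (by simpa using ht)]
    simp [dividedPow, ht.not_ge]
  · rw [← ofReal_integral_eq_lintegral_ofReal]
    · rw [integral_Icc_eq_integral_Ioc, ← intervalIntegral.integral_of_le ht,
        intervalIntegral.integral_comp_sub_left (fun y => y ^ p / p !),
        intervalIntegral.integral_div, integral_pow, dividedPow, if_pos ht]
      congr 1
      rw [Nat.factorial_succ]
      push_cast
      field_simp
      simp
    · exact (Continuous.continuousOn (by fun_prop)).integrableOn_compact isCompact_Icc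
    · refine (ae_restrict_iff' measurableSet_Icc).2 (.of_forall fun y hy => ?_)
      have := sub_nonneg.2 hy.2
      positivity

theorem lintegral_Icc_dividedPow (p : ℕ) (t : ℝ) :
    ∫⁻ y, (if 0 ≤ y ∧ y ≤ t then dividedPow p t else 0) =
      (p + 1 : ℕ) * dividedPow (p + 1) t := by
  have h1 : (fun y => if 0 ≤ y ∧ y ≤ t then dividedPow p t else 0) =
      (Set.Icc 0 t).indicator (fun _ => dividedPow p t) := by
    ext y
    simp [Set.indicator]
  rw [h1, lintegral_indicator_const measurableSet_Icc, Real.volume_Icc, sub_zero]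
  unfold dividedPow
  split_ifs with ht
  · rw [← ENNReal.ofReal_mul (by positivity), ← ENNReal.ofReal_natCast,
      ← ENNReal.ofReal_mul (by positivity), Nat.factorial_succ]
    congr 1
    push_cast
    field_simp
    ring
  · simp

section Chain

variable {A : Type} [Fintype A] {n : ℕ}

/-- The region of the vectors `(y, b)`, with a coordinate `y_a` for each `a : A` and a coordinate
`b_i` for each `i : Fin n`, such that `y ≥ 0`, `∑ y ≤ 1` and
`0 ≤ b_i ≤ 1 - ∑_{ℓ(a) ≤ i} y_a`. -/
def chainRegion (l : A → Fin n) : Set (A ⊕ Fin n → ℝ) :=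
  {x | (∀ a, 0 ≤ x (Sum.inl a)) ∧ (∑ a, x (Sum.inl a) ≤ 1) ∧
    ∀ i, 0 ≤ x (Sum.inr i) ∧ x (Sum.inr i) ≤ 1 - ∑ a with l a ≤ i, x (Sum.inl a)}

variable [DecidableEq A]

/-- The integrand left over from the indicator function of `chainRegion l` when only the variables
`y_a` with `a ∈ J` and `b_i` with `i < m` have not been integrated out, up to a constant factor. -/
noncomputable def chainIntegrand (l : A → Fin n) (J : Finset A) (m p : ℕ)
    (x : A ⊕ Fin n → ℝ) : ℝ≥0∞ :=
  open scoped Classical in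
  if (∀ a ∈ J, 0 ≤ x (Sum.inl a)) ∧ (∀ i : Fin n, (i : ℕ) < m → 0 ≤ x (Sum.inr i) ∧
      x (Sum.inr i) ≤ 1 - ∑ a with l a ≤ i, x (Sum.inl a)) then
    dividedPow p (1 - ∑ a ∈ J, x (Sum.inl a))
  else 0

theorem measurable_chainIntegrand (l : A → Fin n) (J : Finset A) (m p : ℕ) :
    Measurable (chainIntegrand l J m p) := by
  classical
  refine Measurable.ite ?_ ((measurable_dividedPow p).comp (by fun_prop)) measurable_const
  have h1 : ∀ a ∈ J, MeasurableSet {x : A ⊕ Fin n → ℝ | 0 ≤ x (Sum.inl a)} := fun a _ =>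
    measurableSet_le measurable_const (measurable_pi_apply _)
  have h2 : ∀ i : Fin n, MeasurableSet {x : A ⊕ Fin n → ℝ | (i : ℕ) < m →
      0 ≤ x (Sum.inr i) ∧ x (Sum.inr i) ≤ 1 - ∑ a with l a ≤ i, x (Sum.inl a)} := fun i => by
    by_cases h : (i : ℕ) < m
    · simp only [h, true_imp_iff]
      exact (measurableSet_le measurable_const (measurable_pi_apply _)).inter
        (measurableSet_le (measurable_pi_apply _) (by fun_prop))
    · simp [h]
  have h3 := (MeasurableSet.iInter fun a => MeasurableSet.iInter fun ha => h1 a ha).inter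
    (MeasurableSet.iInter h2)
  simp only [← Set.ofPred_forall, ← Set.ofPred_and] at h3
  exact h3

/-- The variable `y_a` does not occur in the bounds on the `b_i` with `i < m ≤ ℓ(a)`. -/
theorem lmarginal_chainIntegrand_inl (l : A → Fin n) (J : Finset A) (m p : ℕ) (a : A)
    (ha : a ∉ J) (hm : m ≤ l a) :
    (∫⋯∫⁻_{Sum.inl a}, chainIntegrand l (insert a J) m p ∂fun _ => volume) =
      chainIntegrand l J m (p + 1) := by
  classical
  rw [lmarginal_singleton]
  ext x
  rw [chainIntegrand, ← lintegral_dividedPow_sub]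
  have hJ : ∀ b ∈ J, b ≠ a := fun b hb h => ha (h ▸ hb)
  have h1 : ∀ y : ℝ, ∀ b ∈ J, Function.update x (Sum.inl a) y (Sum.inl b) = x (Sum.inl b) :=
    fun y b hb => Function.update_of_ne (by simpa using hJ b hb) _ _
  have h2 : ∀ y : ℝ, ∀ i : Fin n, (i : ℕ) < m →
      ∑ b with l b ≤ i, Function.update x (Sum.inl a) y (Sum.inl b) =
        ∑ b with l b ≤ i, x (Sum.inl b) := fun y i hi => by
    refine Finset.sum_congr rfl fun b hb => Function.update_of_ne ?_ _ _
    rintro h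
    obtain rfl := Sum.inl_injective h
    have := (Finset.mem_filter.1 hb).2
    rw [Fin.le_def] at this
    omega
  split_ifs with hc
  · refine lintegral_congr fun y => ?_
    rw [chainIntegrand]
    have h3 : 1 - ∑ b ∈ insert a J, Function.update x (Sum.inl a) y (Sum.inl b) =
        1 - ∑ b ∈ J, x (Sum.inl b) - y := by
      rw [Finset.sum_insert ha, Finset.sum_congr rfl (h1 y), Function.update_self]
      ring
    rw [h3]
    refine if_congr ⟨fun h => ?_, fun h => ⟨fun b hb => ?_, fun i hi => ?_⟩⟩ rfl rfl
    · simpa using h.1 a (Finset.mem_insert_self a J)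
    · rcases Finset.mem_insert.1 hb with rfl | hb
      · simpa using h
      · rw [h1 y b hb]
        exact hc.1 b hb
    · rw [h2 y i hi]
      simpa only [ne_eq, reduceCtorEq, not_false_eq_true, Function.update_of_ne] using hc.2 i hi
  · rw [lintegral_eq_zero_iff' (by
      refine ((measurable_chainIntegrand l (insert a J) m p).comp ?_).aemeasurable
      exact measurable_update x)]
    refine .of_forall fun y => if_neg fun h => hc ⟨fun b hb => ?_, fun i hi => ?_⟩
    · simpa [h1 y b hb] using h.1 b (Finset.mem_insert_of_mem hb)
    · have := h.2 i hi
      rw [h2 y i hi] at this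
      simpa only [ne_eq, reduceCtorEq, not_false_eq_true, Function.update_of_ne] using this

theorem lmarginal_chainIntegrand_inr (l : A → Fin n) (m : Fin n) (p : ℕ) :
    (∫⋯∫⁻_{Sum.inr m}, chainIntegrand l {a | l a ≤ m} (m + 1) p ∂fun _ => volume) =
      ((p + 1 : ℕ) : ℝ≥0∞) • chainIntegrand l {a | l a ≤ m} m (p + 1) := by
  classical
  rw [lmarginal_singleton]
  ext x
  rw [Pi.smul_apply, smul_eq_mul, chainIntegrand, mul_ite, mul_zero, ← lintegral_Icc_dividedPow]
  have h1 : ∀ y : ℝ, ∀ b, Function.update x (Sum.inr m) y (Sum.inl b) = x (Sum.inl b) :=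
    fun y b => Function.update_of_ne (by simp) _ _
  have h2 : ∀ y : ℝ, ∀ i : Fin n, (i : ℕ) < m →
      Function.update x (Sum.inr m) y (Sum.inr i) = x (Sum.inr i) := fun y i hi =>
    Function.update_of_ne (by simp [Fin.ext_iff]; omega) _ _
  split_ifs with hc
  · refine lintegral_congr fun y => ?_
    rw [chainIntegrand]
    simp only [h1]
    refine if_congr ⟨fun h => ?_, fun h => ⟨fun b hb => hc.1 b hb, fun i hi => ?_⟩⟩ rfl rfl
    · simpa using h.2 m (Nat.lt_succ_self _)
    · rcases Nat.lt_succ_iff_lt_or_eq.1 hi with hi | hi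
      · rw [h2 y i hi]
        exact hc.2 i hi
      · obtain rfl := Fin.ext hi
        simpa using h
  · rw [lintegral_eq_zero_iff' (by
      refine ((measurable_chainIntegrand l _ (m + 1) p).comp ?_).aemeasurable
      exact measurable_update x)]
    refine .of_forall fun y => if_neg fun h => hc ⟨fun b hb => ?_, fun i hi => ?_⟩
    · simpa [h1 y b] using h.1 b hb
    · have := h.2 i (hi.trans (Nat.lt_succ_self _))
      simpa only [h1, h2 y i hi] using this

theorem lmarginal_chainIntegrand_image_inl (l : A → Fin n) (J S : Finset A) (m p : ℕ)
    (hJ : Disjoint S J) (hm : ∀ a ∈ S, m ≤ l a) :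
    (∫⋯∫⁻_S.image Sum.inl, chainIntegrand l (S ∪ J) m p ∂fun _ => volume) =
      chainIntegrand l J m (p + #S) := by
  induction S using Finset.induction_on generalizing p with
  | empty => simp
  | insert a S ha ih =>
    rw [Finset.disjoint_insert_left] at hJ
    rw [Finset.image_insert, lmarginal_insert' _ (measurable_chainIntegrand ..) (by simpa using ha),
      Finset.insert_union]
    have := lmarginal_chainIntegrand_inl l (S ∪ J) m p a (by simp [ha, hJ.1])
      (hm a (Finset.mem_insert_self a S))
    rw [lmarginal_singleton] at this
    rw [this, ih _ hJ.2 fun b hb => hm b (Finset.mem_insert_of_mem hb),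
      Finset.card_insert_of_notMem ha]
    congr 1
    ring

/-- The number of `y`- and `b`-variables of level at least `m`. -/
def levelDim (l : A → Fin n) (m : ℕ) : ℕ :=
  #{a | m ≤ (l a : ℕ)} + (n - m)

/-- Integrating out the variables of levels `n - 1, …, m`. The variable `b_k` ranges over an interval
of length `R = 1 - ∑_{ℓ(a) ≤ k} y_a`, which turns `R ^ p / p!` into `p + 1` times the next divided
power, and each of the variables `y_a` of level `k` raises the exponent by one more. -/
theorem lmarginal_chainIntegrand_levels (l : A → Fin n) (m : ℕ) (hm : m ≤ n) :
    (∫⋯∫⁻_({v | m ≤ (Sum.elim l id v : Fin n).val} : Finset (A ⊕ Fin n)),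
      chainIntegrand l univ n 0 ∂fun _ => volume) =
      ((∏ k ∈ Ico m n, (1 + levelDim l (k + 1)) : ℕ) : ℝ≥0∞) •
        chainIntegrand l {a | (l a : ℕ) < m} m (levelDim l m) := by
  induction hm using Nat.decreasingInduction with
  | self =>
    have h1 : ({v | n ≤ (Sum.elim l id v : Fin n).val} : Finset (A ⊕ Fin n)) = ∅ :=
      Finset.filter_eq_empty_iff.2 fun v _ => not_le.2 (Fin.is_lt _)
    have h2 : ({a | (l a : ℕ) < n} : Finset A) = univ :=
      Finset.filter_true_of_mem fun a _ => (l a).2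
    have h3 : levelDim l n = 0 := by
      simp [levelDim]
    rw [h1, h2, h3]
    simp
  | of_succ m hm ih =>
    set k : Fin n := ⟨m, hm⟩ with hk
    have h1 : ({v | m ≤ (Sum.elim l id v : Fin n).val} : Finset (A ⊕ Fin n)) =
        ({a | l a = k} : Finset A).image Sum.inl ∪ ({Sum.inr k} ∪
          ({v | m + 1 ≤ (Sum.elim l id v : Fin n).val} : Finset (A ⊕ Fin n))) := by
      ext (a | i)
      · simp [Fin.ext_iff, hk]; omega
      · simp [Fin.ext_iff, hk]; omega
    have h2 : ({a | (l a : ℕ) < m + 1} : Finset A) = ({a | l a ≤ k} : Finset A) := by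
      ext a; simp [Fin.le_def, hk]
    have h3 : ({a | l a ≤ k} : Finset A) =
        ({a | l a = k} : Finset A) ∪ ({a | (l a : ℕ) < m} : Finset A) := by
      ext a; simp [Fin.ext_iff, Fin.le_def, hk]; omega
    have hd1 : Disjoint ({a | l a = k} : Finset A) ({a | (l a : ℕ) < m} : Finset A) := by
      rw [Finset.disjoint_filter]
      rintro a - h
      simp [h, hk]
    have hdim : levelDim l (m + 1) + 1 + #({a | l a = k} : Finset A) = levelDim l m := by
      have : ({a | m ≤ (l a : ℕ)} : Finset A) =
          ({a | l a = k} : Finset A) ∪ ({a | m + 1 ≤ (l a : ℕ)} : Finset A) := by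
        ext a; simp [Fin.ext_iff, hk]; omega
      rw [levelDim, levelDim, this, Finset.card_union_of_disjoint]
      · omega
      · rw [Finset.disjoint_filter]
        rintro a - h
        simp [h, hk]
    have hmeas : Measurable (chainIntegrand l univ n 0) := measurable_chainIntegrand ..
    rw [h1, lmarginal_union _ _ hmeas, lmarginal_union _ _ hmeas, ih, h2]
    · have hsmul : ∀ (s : Finset (A ⊕ Fin n)) (c : ℕ) (f : (A ⊕ Fin n → ℝ) → ℝ≥0∞),
          (∫⋯∫⁻_s, ((c : ℝ≥0∞) • f) ∂fun _ => volume) =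
            (c : ℝ≥0∞) • ∫⋯∫⁻_s, f ∂fun _ => (volume : Measure ℝ) := fun s c f => by
        ext x
        simp only [lmarginal, Pi.smul_apply, smul_eq_mul]
        exact lintegral_const_mul' _ _ (ENNReal.natCast_ne_top c)
      rw [hsmul, hsmul]
      have := lmarginal_chainIntegrand_inr l k (levelDim l (m + 1))
      rw [show (k : ℕ) = m from rfl] at this
      rw [this, hsmul, h3, lmarginal_chainIntegrand_image_inl l _ _ _ _ hd1, hdim,
        Finset.prod_eq_prod_Ico_succ_bot hm, smul_smul, mul_comm, add_comm 1]
      · push_cast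
        rfl
      · intro a ha
        rw [(Finset.mem_filter.1 ha).2]
    · simp [hk]
    · rw [Finset.disjoint_left]
      rintro v hv hv'
      obtain ⟨a, ha, rfl⟩ := Finset.mem_image.1 hv
      simp at ha
      simp [ha, hk] at hv'

theorem indicator_chainRegion (l : A → Fin n) :
    (chainRegion l).indicator 1 = chainIntegrand l univ n 0 := by
  classical
  ext x
  simp only [Set.indicator, chainRegion, chainIntegrand, dividedPow, Set.mem_ofPred_eq]
  simp
  grind

theorem measurableSet_chainRegion (l : A → Fin n) : MeasurableSet (chainRegion l) := by
  have : chainRegion l = chainIntegrand l univ n 0 ⁻¹' {1} := by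
    ext x
    simp [← indicator_chainRegion, Set.indicator]
  rw [this]
  exact measurable_chainIntegrand l univ n 0 (measurableSet_singleton 1)

theorem volume_chainRegion (l : A → Fin n) :
    ((Fintype.card A + n)! : ℝ≥0∞) * volume (chainRegion l) =
      (∏ k ∈ range n, (1 + levelDim l (k + 1)) : ℕ) := by
  have h2 := congrFun (lmarginal_chainIntegrand_levels l 0 (Nat.zero_le n)) 0
  have h3 : levelDim l 0 = Fintype.card A + n := by simp [levelDim]
  simp only [Nat.zero_le, Finset.filter_true, Nat.not_lt_zero, Finset.filter_false] at h2
  rw [lmarginal_univ, ← indicator_chainRegion, ← volume_pi,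
    lintegral_indicator_one (measurableSet_chainRegion l), h3] at h2
  beta_reduce at h2
  rw [h2, Pi.smul_apply, smul_eq_mul, mul_left_comm, Finset.range_eq_Ico]
  have h4 : chainIntegrand l ∅ 0 (Fintype.card A + n) 0 =
      ((Fintype.card A + n)! : ℝ≥0∞)⁻¹ := by
    simp only [chainIntegrand, dividedPow]
    simp [ENNReal.ofReal_inv_of_pos, Nat.factorial_pos]
  rw [h4, ENNReal.mul_inv_cancel (by simp [Nat.factorial_ne_zero]) (ENNReal.natCast_ne_top _),
    mul_one]

end Chain

end Region

/-! ### Flows on the oruga graph -/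

section Flows

variable {n : ℕ} {s : Fin n → ℕ}

/-- The total flow on the source-edges entering `v_{n-j}`. -/
def sourceFlow (f : EuclideanSpace ℝ (OrugaEdge s)) (j : Fin (n + 1)) : ℝ :=
  ∑ k, f (Sum.inl ⟨j, k⟩)

/-- The total flow from `v_{n-m}` to `v_{n+1-m}`, on the bump and the dip, for `m ∈ [1, n]`. It is
`0` for the remaining `m`, so that conservation takes the same form at every `v_j`, `j ∈ [0, n]`. -/
def stepFlow (f : EuclideanSpace ℝ (OrugaEdge s)) (m : ℕ) : ℝ :=
  if h : 0 < m ∧ m ≤ n then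
    f (Sum.inr (Sum.inl ⟨m - 1, by omega⟩)) + f (Sum.inr (Sum.inr ⟨m - 1, by omega⟩)) else 0

theorem stepFlow_succ (f : EuclideanSpace ℝ (OrugaEdge s)) (i : Fin n) :
    stepFlow f (i + 1) = f (Sum.inr (Sum.inl i)) + f (Sum.inr (Sum.inr i)) := by
  rw [stepFlow, dif_pos ⟨by omega, by omega⟩]
  rfl

/-- The vertex `v_{n-j}`, for `j ∈ [0, n]`. -/
def orugaVertex (j : Fin (n + 1)) : Fin (n + 2) := ⟨n + 1 - j, by omega⟩

theorem sum_tgt_orugaVertex (f : EuclideanSpace ℝ (OrugaEdge s)) (j : Fin (n + 1)) :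
    ∑ e with (oruga s).tgt e = orugaVertex j, f e = sourceFlow f j + stepFlow f (j + 1) := by
  have h1 : ∀ i : Fin (n + 1), n + 1 - i.val = n + 1 - j.val ↔ i = j := fun i => by
    rw [Fin.ext_iff]
    omega
  rw [Finset.sum_filter, Fintype.sum_sum_type, Fintype.sum_sum_type, Fintype.sum_sigma]
  simp only [oruga, orugaVertex, Fin.mk.injEq, h1]
  congr 1
  · rw [Fintype.sum_eq_single j fun i hi => by simp [hi]]
    simp [sourceFlow]
  · rcases Nat.lt_or_ge j n with hj | hj
    · have h2 : ∀ i : Fin n, n + 1 - i.val = n + 1 - j.val ↔ i = ⟨j, hj⟩ := fun i => by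
        rw [Fin.ext_iff]
        change _ ↔ i.val = j.val
        omega
      simp [h2, stepFlow_succ f ⟨j, hj⟩]
    · have h2 : ∀ i : Fin n, ¬ n + 1 - i.val = n + 1 - j.val := fun i => by omega
      simp [h2, stepFlow, hj]

theorem sum_src_orugaVertex (f : EuclideanSpace ℝ (OrugaEdge s)) (j : Fin (n + 1)) :
    ∑ e with (oruga s).src e = orugaVertex j, f e = stepFlow f j := by
  have h1 : ¬ (0 : Fin (n + 2)) = ⟨n + 1 - j, by omega⟩ := by
    rw [Fin.ext_iff, Fin.val_zero]
    change ¬ 0 = n + 1 - j.val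
    omega
  rw [Finset.sum_filter, Fintype.sum_sum_type, Fintype.sum_sum_type, Fintype.sum_sigma]
  simp only [oruga, orugaVertex, Fin.mk.injEq, h1, if_false, Finset.sum_const_zero, zero_add]
  rcases Nat.eq_zero_or_pos j.val with hj | hj
  · have h2 : ∀ i : Fin n, ¬ n - i.val = n + 1 - j.val := fun i => by omega
    simp only [h2, if_false, Finset.sum_const_zero]
    simp [stepFlow, hj]
  · have h2 : ∀ i : Fin n, n - i.val = n + 1 - j.val ↔ i = ⟨j - 1, by omega⟩ := fun i => by
      rw [Fin.ext_iff]
      change _ ↔ i.val = j - 1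
      omega
    simp only [h2]
    rw [stepFlow, dif_pos ⟨hj, by omega⟩]
    simp

theorem sum_tgt_zero (f : EuclideanSpace ℝ (OrugaEdge s)) :
    ∑ e with (oruga s).tgt e = 0, f e = 0 := by
  refine Finset.sum_eq_zero fun e he => ?_
  exfalso
  have h := congrArg Fin.val (Finset.mem_filter.1 he).2
  rcases e with e | i | i <;> simp [oruga] at h <;> omega

theorem sum_src_zero (f : EuclideanSpace ℝ (OrugaEdge s)) :
    ∑ e with (oruga s).src e = 0, f e = ∑ j, sourceFlow f j := by
  have h2 : ∀ i : Fin n, ¬ (⟨n - i, by omega⟩ : Fin (n + 2)) = 0 := fun i => by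
    rw [Fin.ext_iff, Fin.val_zero]
    change ¬ n - i.val = 0
    omega
  rw [Finset.sum_filter, Fintype.sum_sum_type, Fintype.sum_sum_type, Fintype.sum_sigma]
  simp [oruga, h2, sourceFlow]

theorem forall_vertex_iff {p : Fin (n + 2) → Prop} :
    (∀ v, p v) ↔ p 0 ∧ ∀ j : Fin (n + 1), p (orugaVertex j) := by
  refine ⟨fun h => ⟨h 0, fun j => h _⟩, fun h v => ?_⟩
  by_cases hv : v = 0
  · exact hv ▸ h.1
  · have hv' : v.val ≠ 0 := fun h => hv (Fin.ext h)
    have : v = orugaVertex ⟨n + 1 - v, by omega⟩ := by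
      rw [Fin.ext_iff]
      change v.val = n + 1 - (n + 1 - v)
      omega
    rw [this]
    exact h.2 _

/-- Summing the conservation laws at `v_n, v_{n-1}, …` determines the flow that passes from each
vertex to the next one. -/
theorem mem_flowPolytope_oruga_iff (a : Fin (n + 2) → ℝ) (f : EuclideanSpace ℝ (OrugaEdge s)) :
    f ∈ flowPolytope (oruga s) a ↔ (∀ e, 0 ≤ f e) ∧ ∑ j, sourceFlow f j = a 0 ∧
      ∑ j, (sourceFlow f j + a (orugaVertex j)) = 0 ∧
      ∀ i : Fin n, f (Sum.inr (Sum.inl i)) + f (Sum.inr (Sum.inr i)) =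
        -∑ j with j ≤ i.castSucc, (sourceFlow f j + a (orugaVertex j)) := by
  simp only [flowPolytope, Set.mem_ofPred_eq, forall_vertex_iff, sum_tgt_orugaVertex,
    sum_src_orugaVertex, sum_tgt_zero, sum_src_zero, zero_add]
  refine and_congr_right fun _ => and_congr eq_comm ?_
  have hsum : ∀ j : Fin (n + 1),
      ∑ i : Fin (n + 1) with i.val < j.val + 1, (sourceFlow f i + a (orugaVertex i)) =
        sourceFlow f j + a (orugaVertex j) +
          ∑ i : Fin (n + 1) with i.val < j.val, (sourceFlow f i + a (orugaVertex i)) := fun j => by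
    have : ({i | i.val < j.val + 1} : Finset (Fin (n + 1))) =
        insert j ({i | i.val < j.val} : Finset (Fin (n + 1))) := by
      ext i; simp [Fin.ext_iff]; omega
    rw [this, Finset.sum_insert (by simp)]
  have hle : ∀ i : Fin n, ({j | j ≤ i.castSucc} : Finset (Fin (n + 1))) =
      ({j | j.val < i.val + 1} : Finset (Fin (n + 1))) := fun i => by
    ext j; simp [Fin.le_def]
  have huniv : (univ : Finset (Fin (n + 1))) = ({j | j.val < n + 1} : Finset (Fin (n + 1))) := by
    ext j; simp [j.is_le]
  have hlast : stepFlow f (n + 1) = 0 := dif_neg (by omega)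
  simp only [hle, ← stepFlow_succ]
  constructor
  · intro h
    have h1 : ∀ m ≤ n + 1, stepFlow f m =
        -∑ j : Fin (n + 1) with j.val < m, (sourceFlow f j + a (orugaVertex j)) := fun m hm => by
      induction m with
      | zero => simp [stepFlow]
      | succ m ih =>
        have h2 := h ⟨m, hm⟩
        have h3 := hsum ⟨m, hm⟩
        have h4 := ih (by omega)
        simp only at h2 h3
        linarith
    refine ⟨?_, fun i => h1 _ (by omega)⟩
    have := h1 (n + 1) le_rfl
    rw [huniv]
    linarith
  · rintro ⟨h1, h2⟩ j
    have h3 : ∀ m ≤ n + 1, stepFlow f m =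
        -∑ j : Fin (n + 1) with j.val < m, (sourceFlow f j + a (orugaVertex j)) := fun m hm => by
      rcases Nat.eq_zero_or_pos m with rfl | h0
      · simp [stepFlow]
      · rcases hm.lt_or_eq with hm | rfl
        · obtain ⟨i, rfl⟩ := Nat.exists_eq_succ_of_ne_zero h0.ne'
          exact h2 ⟨i, by omega⟩
        · rw [hlast, ← huniv, h1, neg_zero]
    have h4 := h3 j (by omega)
    have h5 := h3 (j + 1) (by omega)
    have h6 := hsum j
    linarith

theorem sum_filter_le_castSucc (F : Fin (n + 1) → ℝ) (i : Fin n) :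
    ∑ j with j ≤ i.castSucc, F j = ∑ j with j ≤ i, F (Fin.castSucc j) := by
  rw [Finset.sum_filter, Fin.sum_univ_castSucc, Finset.sum_filter]
  simp [Fin.not_le.2 (Fin.castSucc_lt_last i)]

/-! ### Integer flows -/

theorem dNetflow_zero (s : Fin n → ℕ) : dNetflow s 0 = 0 := by
  simp [dNetflow, Fin.ext_iff]

theorem dNetflow_orugaVertex_castSucc (s : Fin n → ℕ) (j : Fin n) :
    dNetflow s (orugaVertex j.castSucc) =
      (s j : ℝ) - if j.val = 0 then (tailSum s 0 : ℝ) else 0 := by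
  have htail : (tailSum s 1 : ℝ) = ∑ i ∈ {i : Fin n | 1 ≤ (i : ℕ)}, (s i : ℝ) := by
    simp [tailSum]
  by_cases hj : j.val = 0
  · have h1 : orugaVertex j.castSucc = Fin.last (n + 1) := by
      simp [orugaVertex, Fin.ext_iff, hj]
    have h2 := tailSum_succ s j
    rw [hj] at h2
    rw [dNetflow, if_pos h1, if_pos hj, h2, ← htail]
    push_cast
    ring
  · have h1 : orugaVertex j.castSucc ≠ Fin.last (n + 1) := by
      simp [orugaVertex, Fin.ext_iff]
      omega
    have h2 : 2 ≤ (orugaVertex j.castSucc).val := by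
      change 2 ≤ n + 1 - j.val
      omega
    rw [dNetflow, if_neg h1, dif_pos h2, if_neg hj, sub_zero]
    congr 2
    rw [Fin.ext_iff]
    change n + 1 - (n + 1 - j.val) = j.val
    omega

theorem dNetflow_orugaVertex_last (s : Fin n → ℕ) :
    dNetflow s (orugaVertex (Fin.last n)) = 0 := by
  have h2 : ¬ 2 ≤ (orugaVertex (Fin.last n)).val := by
    change ¬ 2 ≤ n + 1 - n
    omega
  rw [dNetflow, dif_neg h2, ite_eq_right_iff]
  intro h
  have : n = 0 := by
    have := congrArg Fin.val h
    change n + 1 - n = n + 1 at this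
    omega
  subst this
  simp

theorem sum_dNetflow_le (s : Fin n → ℕ) (i : Fin n) :
    ∑ j with j ≤ i, dNetflow s (orugaVertex (Fin.castSucc j)) = -(tailSum s (i + 1) : ℝ) := by
  have h1 : ∀ m (hm : m < n), ∑ j : Fin n with j.val ≤ m,
      dNetflow s (orugaVertex (Fin.castSucc j)) = -(tailSum s (m + 1) : ℝ) := by
    intro m hm
    induction m with
    | zero =>
      have : ({j | j.val ≤ 0} : Finset (Fin n)) = {⟨0, hm⟩} := by
        ext j; simp [Fin.ext_iff]
      rw [this, Finset.sum_singleton, dNetflow_orugaVertex_castSucc, if_pos rfl,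
        tailSum_succ s ⟨0, hm⟩]
      push_cast
      ring
    | succ m ih =>
      have : ({j | j.val ≤ m + 1} : Finset (Fin n)) =
          insert ⟨m + 1, hm⟩ ({j | j.val ≤ m} : Finset (Fin n)) := by
        ext j; simp [Fin.ext_iff]; omega
      rw [this, Finset.sum_insert (by simp), ih (by omega), dNetflow_orugaVertex_castSucc,
        if_neg (by simp), tailSum_succ s ⟨m + 1, hm⟩]
      push_cast
      ring
  exact h1 i i.2

theorem sum_dNetflow (s : Fin n → ℕ) : ∑ j, dNetflow s (orugaVertex j) = 0 := by
  rw [Fin.sum_univ_castSucc, dNetflow_orugaVertex_last, add_zero]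
  rcases Nat.eq_zero_or_pos n with rfl | hn
  · simp
  · have h1 := sum_dNetflow_le s ⟨n - 1, by omega⟩
    have h2 : ({j | j ≤ ⟨n - 1, by omega⟩} : Finset (Fin n)) = univ := by
      ext j; simp [Fin.le_def]; omega
    have h3 : tailSum s (n - 1 + 1) = 0 := by
      rw [tailSum, Finset.sum_eq_zero]
      intro i hi
      have := (Finset.mem_filter.1 hi).2
      omega
    rw [h2, h3] at h1
    simpa using h1

/-- No flow enters through the source-edges, and from `v_{n-i}` to `v_{n+1-i}` a flow of
`s_{i+1} + ⋯ + s_n` is split between the bump and the dip. -/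
theorem mem_flowPolytope_dNetflow_iff (f : EuclideanSpace ℝ (OrugaEdge s)) :
    f ∈ flowPolytope (oruga s) (dNetflow s) ↔ (∀ e, f (Sum.inl e) = 0) ∧
      ∀ i : Fin n, 0 ≤ f (Sum.inr (Sum.inl i)) ∧ 0 ≤ f (Sum.inr (Sum.inr i)) ∧
        f (Sum.inr (Sum.inl i)) + f (Sum.inr (Sum.inr i)) = tailSum s (i + 1) := by
  rw [mem_flowPolytope_oruga_iff, dNetflow_zero]
  have hkey : (∀ e, f (Sum.inl e) = 0) → ∀ j, sourceFlow f j = 0 := fun h j =>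
    Finset.sum_eq_zero fun k _ => h _
  constructor
  · rintro ⟨h1, h2, -, h4⟩
    have h5 : ∀ e, f (Sum.inl e) = 0 := by
      rintro ⟨j, k⟩
      have h6 := (Finset.sum_eq_zero_iff_of_nonneg
        fun j _ => (Finset.sum_nonneg fun k _ => h1 _ : 0 ≤ sourceFlow f j)).1 h2 j (Finset.mem_univ j)
      exact (Finset.sum_eq_zero_iff_of_nonneg fun k' _ => h1 (Sum.inl ⟨j, k'⟩)).1 h6 k
        (Finset.mem_univ k)
    refine ⟨h5, fun i => ⟨h1 _, h1 _, ?_⟩⟩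
    simp only [h4 i, hkey h5, zero_add]
    rw [sum_filter_le_castSucc, sum_dNetflow_le, neg_neg]
  · rintro ⟨h1, h2⟩
    refine ⟨?_, ?_, ?_, fun i => ?_⟩
    · rintro (e | i | i)
      · exact (h1 e).ge
      · exact (h2 i).1
      · exact (h2 i).2.1
    · simp [hkey h1]
    · simp [hkey h1, sum_dNetflow]
    · simp only [(h2 i).2.2, hkey h1, zero_add]
      rw [sum_filter_le_castSucc, sum_dNetflow_le, neg_neg]

/-- An integer flow is determined by its values on the bumps. -/
noncomputable def bumpEquiv (s : Fin n → ℕ) :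
    ((i : Fin n) → Fin (tailSum s (i + 1) + 1)) ≃ integerFlows (oruga s) (dNetflow s) :=
  Equiv.ofBijective
    (fun b => ⟨WithLp.toLp 2 (Sum.elim (fun _ => 0) (Sum.elim (fun i => ((b i : ℕ) : ℝ))
      fun i => ((tailSum s (i + 1) - b i : ℕ) : ℝ))), by
      refine ⟨(mem_flowPolytope_dNetflow_iff _).2 ⟨fun _ => rfl, fun i => ?_⟩, ?_⟩
      · refine ⟨Nat.cast_nonneg _, Nat.cast_nonneg _, ?_⟩
        have : (b i : ℕ) + (tailSum s (i + 1) - b i) = tailSum s (i + 1) := by omega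
        change ((b i : ℕ) : ℝ) + ((tailSum s (i + 1) - b i : ℕ) : ℝ) = _
        exact_mod_cast this
      · rintro (e | i | i)
        · exact ⟨0, by simp⟩
        · exact ⟨(b i : ℕ), by simp⟩
        · exact ⟨(tailSum s (i + 1) - b i : ℕ), by simp⟩⟩) <| by
    constructor
    · intro b b' h
      ext i
      have := congrArg (fun f : EuclideanSpace ℝ (OrugaEdge s) => f (Sum.inr (Sum.inl i)))
        (congrArg Subtype.val h)
      exact Nat.cast_injective (R := ℝ) this
    · rintro ⟨f, hf, hint⟩
      obtain ⟨h1, h2⟩ := (mem_flowPolytope_dNetflow_iff f).1 hf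
      have h3 : ∀ i : Fin n, ∃ m : ℕ, f (Sum.inr (Sum.inl i)) = m := fun i => by
        obtain ⟨m, hm⟩ := hint (Sum.inr (Sum.inl i))
        have h0 := (h2 i).1
        rw [hm, Int.cast_nonneg_iff] at h0
        lift m to ℕ using h0
        exact ⟨m, by simpa using hm⟩
      choose m hm using h3
      have h4 : ∀ i : Fin n, m i ≤ tailSum s (i + 1) := fun i => by
        have h5 := (h2 i).2.2
        have h6 := (h2 i).2.1
        rw [hm i] at h5
        exact_mod_cast (by linarith : (m i : ℝ) ≤ tailSum s (i + 1))
      refine ⟨fun i => ⟨m i, Nat.lt_succ_of_le (h4 i)⟩, Subtype.ext ?_⟩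
      ext (e | i | i)
      · exact (h1 e).symm
      · exact (hm i).symm
      · have h5 := (h2 i).2.2
        rw [hm i] at h5
        change ((tailSum s (i + 1) - m i : ℕ) : ℝ) = _
        rw [Nat.cast_sub (h4 i)]
        linarith

/-! ### The volume of the flow polytope -/

/-- The source-edges other than the one that enters `v_0`. -/
abbrev FreeSource (s : Fin n → ℕ) : Type := Σ i : Fin n, Fin (extend s i.castSucc - 1)

theorem sum_fst_le (x : FreeSource s → ℝ) (i : Fin n) :
    ∑ a with a.1 ≤ i, x a = ∑ j with j ≤ i, ∑ k, x ⟨j, k⟩ := by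
  rw [Finset.sum_filter, Fintype.sum_sigma, Finset.sum_filter]
  refine Finset.sum_congr rfl fun j _ => ?_
  split_ifs <;> simp

theorem levelDim_freeSource (s : Fin n → ℕ) (hs : ∀ i, 0 < s i) (m : ℕ) :
    levelDim (fun a : FreeSource s => a.1) m = tailSum s m := by
  have h1 : #{a : FreeSource s | m ≤ (a.1 : ℕ)} =
      ∑ r : Fin n with m ≤ r.val, (s r - 1) := by
    rw [Finset.card_filter, Fintype.sum_sigma, Finset.sum_filter]
    refine Finset.sum_congr rfl fun r _ => ?_
    change (∑ _k : Fin (extend s r.castSucc - 1), if m ≤ r.val then 1 else 0) = _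
    rw [Finset.sum_const, Finset.card_univ, Fintype.card_fin, extend, Fin.snoc_castSucc]
    split_ifs <;> simp
  have h2 : n - m = ∑ r : Fin n with m ≤ r.val, 1 := by
    rw [← Finset.card_eq_sum_ones]
    have h3 := Finset.card_filter_add_card_filter_not (s := univ) fun r : Fin n => r.val < m
    simp only [Fin.card_filter_val_lt, not_lt, Finset.card_univ, Fintype.card_fin] at h3
    omega
  rw [levelDim, h1, h2, ← Finset.sum_add_distrib, tailSum]
  refine Finset.sum_congr rfl fun r _ => ?_
  have := hs r
  omega

/-- The linear part of the parametrization of the flows with unit netflow by their values on the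
free source-edges and the bumps. -/
noncomputable def flowLinear (s : Fin n → ℕ) :
    (FreeSource s ⊕ Fin n → ℝ) →ₗ[ℝ] EuclideanSpace ℝ (OrugaEdge s) where
  toFun x := WithLp.toLp 2 (Sum.elim
    (fun e => Fin.lastCases (motive := fun i => Fin (extend s i - 1) → ℝ)
      (fun _ => -∑ a, x (Sum.inl a)) (fun i k => x (Sum.inl ⟨i, k⟩)) e.1 e.2)
    (Sum.elim (fun i => x (Sum.inr i))
      fun i => -(∑ a with a.1 ≤ i, x (Sum.inl a)) - x (Sum.inr i)))
  map_add' x y := by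
    ext (⟨i, k⟩ | i | i)
    · induction i using Fin.lastCases with
      | last => simp [Finset.sum_add_distrib]; ring
      | cast i => simp
    · simp
    · simp [Finset.sum_add_distrib]; ring
  map_smul' c x := by
    ext (⟨i, k⟩ | i | i)
    · induction i using Fin.lastCases with
      | last => simp [Finset.mul_sum]
      | cast i => simp
    · simp
    · simp [← Finset.mul_sum]; ring

/-- The flow along the edge to `v_0` and all the dips. -/
noncomputable def dipFlow (s : Fin n → ℕ) : EuclideanSpace ℝ (OrugaEdge s) :=
  WithLp.toLp 2 (Sum.elim (fun e => if e.1 = Fin.last n then 1 else 0)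
    (Sum.elim (fun _ => 0) fun _ => 1))

section Parametrization

variable (x : FreeSource s ⊕ Fin n → ℝ)

theorem flowLinear_castSucc (i : Fin n) (k) :
    flowLinear s x (Sum.inl ⟨i.castSucc, k⟩) = x (Sum.inl ⟨i, k⟩) := by
  simp [flowLinear]

theorem flowLinear_last (k) :
    flowLinear s x (Sum.inl ⟨Fin.last n, k⟩) = -∑ a, x (Sum.inl a) := by
  simp [flowLinear]

theorem flowLinear_bump (i : Fin n) :
    flowLinear s x (Sum.inr (Sum.inl i)) = x (Sum.inr i) := rfl

theorem flowLinear_dip (i : Fin n) :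
    flowLinear s x (Sum.inr (Sum.inr i)) =
      -(∑ a with a.1 ≤ i, x (Sum.inl a)) - x (Sum.inr i) := rfl

end Parametrization

theorem extend_last_sub_one (s : Fin n → ℕ) : extend s (Fin.last n) - 1 = 1 := by
  simp [extend]

theorem sourceFlow_last (f : EuclideanSpace ℝ (OrugaEdge s)) (k) :
    sourceFlow f (Fin.last n) = f (Sum.inl ⟨Fin.last n, k⟩) := by
  have : Subsingleton (Fin (extend s (Fin.last n) - 1)) := by
    rw [extend_last_sub_one]; infer_instance
  exact Fintype.sum_subsingleton _ k

theorem mem_flowPolytope_unitNetflow_iff (f : EuclideanSpace ℝ (OrugaEdge s)) :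
    f ∈ flowPolytope (oruga s) (unitNetflow n) ↔ (∀ e, 0 ≤ f e) ∧ ∑ j, sourceFlow f j = 1 ∧
      ∀ i : Fin n, f (Sum.inr (Sum.inl i)) + f (Sum.inr (Sum.inr i)) =
        1 - ∑ j with j ≤ i, sourceFlow f (Fin.castSucc j) := by
  have h0 : unitNetflow n 0 = 1 := rfl
  have h1 : ∀ j : Fin (n + 1), unitNetflow n (orugaVertex j) = if j = 0 then -1 else 0 := by
    intro j
    have h2 : orugaVertex j ≠ 0 := by
      rw [Ne, Fin.ext_iff]
      change ¬ n + 1 - j.val = 0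
      omega
    have h3 : orugaVertex j = Fin.last (n + 1) ↔ j = 0 := by
      rw [Fin.ext_iff, Fin.ext_iff]
      change n + 1 - j.val = n + 1 ↔ j.val = 0
      omega
    simp [unitNetflow, h2, h3]
  have h4 : ∀ i : Fin n, -∑ j with j ≤ i.castSucc,
      (sourceFlow f j + unitNetflow n (orugaVertex j)) =
        1 - ∑ j with j ≤ i, sourceFlow f (Fin.castSucc j) := fun i => by
    rw [← sum_filter_le_castSucc, Finset.sum_add_distrib]
    simp [h1]
    ring
  rw [mem_flowPolytope_oruga_iff, h0]
  simp only [h4]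
  -- Conservation at `v_0` follows from the total flow on the source-edges being `1`.
  refine and_congr_right fun _ => and_congr_right fun h => and_iff_right ?_
  rw [Finset.sum_add_distrib, h]
  simp [h1]

/-- The polytope of flows with unit netflow is parametrized by `chainRegion`: the flow on the edge
to `v_0` and on the dips is determined by the conservation laws, and the inequalities of
`chainRegion` express the nonnegativity of the flow. -/
theorem flowPolytope_eq_image (s : Fin n → ℕ) :
    flowPolytope (oruga s) (unitNetflow n) =
      (fun x => flowLinear s x + dipFlow s) '' chainRegion (fun a : FreeSource s => a.1) := by
  let k₀ : Fin (extend s (Fin.last n) - 1) := ⟨0, by rw [extend_last_sub_one]; exact one_pos⟩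
  ext f
  rw [mem_flowPolytope_unitNetflow_iff]
  constructor
  · rintro ⟨h1, h2, h3⟩
    rw [Fin.sum_univ_castSucc, sourceFlow_last f k₀] at h2
    have h4 : ∑ a : FreeSource s, f (Sum.inl ⟨a.1.castSucc, a.2⟩) =
        ∑ j : Fin n, sourceFlow f j.castSucc := Fintype.sum_sigma _
    have h5 : ∀ i : Fin n, ∑ a : FreeSource s with a.1 ≤ i, f (Sum.inl ⟨a.1.castSucc, a.2⟩) =
        ∑ j with j ≤ i, sourceFlow f (Fin.castSucc j) := fun i => sum_fst_le _ i
    refine ⟨Sum.elim (fun a => f (Sum.inl ⟨a.1.castSucc, a.2⟩))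
      fun i => f (Sum.inr (Sum.inl i)), ⟨fun a => h1 _, ?_, fun i => ⟨h1 _, ?_⟩⟩, ?_⟩
    · have := h1 (Sum.inl ⟨Fin.last n, k₀⟩)
      simp only [Sum.elim_inl, h4]
      linarith
    · have := h1 (Sum.inr (Sum.inr i))
      have := h3 i
      simp only [Sum.elim_inl, Sum.elim_inr, h5]
      linarith
    · ext (⟨i, k⟩ | i | i)
      · rw [PiLp.add_apply]
        induction i using Fin.lastCases with
        | last =>
          rw [flowLinear_last]
          simp only [Sum.elim_inl, h4, ← sourceFlow_last f k]
          rw [← sourceFlow_last f k₀] at h2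
          simp [dipFlow]
          linarith
        | cast i =>
          rw [flowLinear_castSucc]
          simp [dipFlow]
      · rw [PiLp.add_apply, flowLinear_bump]
        simp [dipFlow]
      · rw [PiLp.add_apply, flowLinear_dip]
        have := h3 i
        simp only [Sum.elim_inl, Sum.elim_inr, h5]
        simp [dipFlow]
        linarith
  · rintro ⟨x, ⟨h1, h2, h3⟩, rfl⟩
    have h4 : ∀ j : Fin n, sourceFlow (flowLinear s x + dipFlow s) j.castSucc =
        ∑ k, x (Sum.inl ⟨j, k⟩) := fun j => by
      simp [sourceFlow, flowLinear_castSucc, dipFlow]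
    refine ⟨?_, ?_, fun i => ?_⟩
    · rintro (⟨i, k⟩ | i | i)
      · rw [PiLp.add_apply]
        induction i using Fin.lastCases with
        | last =>
          rw [flowLinear_last]
          simp [dipFlow]
          linarith
        | cast i =>
          rw [flowLinear_castSucc]
          simp [dipFlow, h1]
      · rw [PiLp.add_apply, flowLinear_bump]
        simp [dipFlow, (h3 i).1]
      · have := (h3 i).2
        rw [PiLp.add_apply, flowLinear_dip]
        simp [dipFlow]
        linarith
    · rw [Fin.sum_univ_castSucc, sourceFlow_last _ k₀, PiLp.add_apply, flowLinear_last,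
        Fintype.sum_sigma]
      simp only [h4]
      simp [dipFlow]
    · rw [PiLp.add_apply, PiLp.add_apply, flowLinear_bump, flowLinear_dip]
      have h5 := sum_fst_le (fun a => x (Sum.inl a)) i
      simp only [h4, ← h5]
      simp [dipFlow]
      ring

theorem normalizedVolume_flowPolytope (s : Fin n → ℕ) (hs : ∀ i, 0 < s i) :
    normalizedVolume (flowPolytope (oruga s) (unitNetflow n)) =
      (∏ k ∈ range n, (1 + tailSum s (k + 1)) : ℕ) := by
  rw [flowPolytope_eq_image, normalizedVolume_affine_image (flowLinear s)
    (Sum.elim (fun a => Sum.inl ⟨a.1.castSucc, a.2⟩) fun i => Sum.inr (Sum.inl i))]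
  · have := volume_chainRegion (fun a : FreeSource s => a.1)
    simp only [levelDim_freeSource s hs] at this
    rw [← this, Fintype.card_sum, Fintype.card_fin]
  · rintro x (a | i)
    · exact flowLinear_castSucc x a.1 a.2
    · rfl
  · have hint : ∀ v e, ∃ k : ℤ, flowLinear s (fun w => ((Pi.single v 1 : _ → ℤ) w : ℝ)) e = k := by
      rintro v (⟨i, k⟩ | i | i)
      · induction i using Fin.lastCases with
        | last =>
          rw [flowLinear_last]
          exact ⟨-∑ a, (Pi.single v 1 : _ → ℤ) (Sum.inl a), by push_cast; rfl⟩
        | cast i =>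
          rw [flowLinear_castSucc]
          exact ⟨_, rfl⟩
      · exact ⟨_, rfl⟩
      · rw [flowLinear_dip]
        exact ⟨-(∑ a with a.1 ≤ i, (Pi.single v 1 : _ → ℤ) (Sum.inl a)) -
          (Pi.single v 1 : _ → ℤ) (Sum.inr i), by push_cast; rfl⟩
    intro v e
    have hv : (Pi.single v 1 : _ → ℝ) = fun w => ((Pi.single v 1 : _ → ℤ) w : ℝ) := by
      ext w
      simp [Pi.single_apply]
    rw [hv]
    exact hint v e
  · exact ⟨by simp, by simp, by simp⟩
  · rintro (a | i)
    · refine ⟨fun b => ?_, ?_, fun j => ⟨?_, ?_⟩⟩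
      · rw [Pi.single_apply]; split_ifs <;> simp
      · simp [Pi.single_apply]
      · simp
      · simp [Pi.single_apply]
        split_ifs <;> simp
    · refine ⟨fun b => ?_, ?_, fun j => ⟨?_, ?_⟩⟩
      · simp
      · simp
      · rw [Pi.single_apply]; split_ifs <;> simp
      · simp [Pi.single_apply]
        split_ifs <;> simp
  · exact measurableSet_chainRegion _

/-- The factor for `k = n - 1` is `1`; the others are matched by `i = n - 1 - k`. -/
theorem prod_tailSum_eq (s : Fin n → ℕ) :
    ∏ k ∈ range n, (1 + tailSum s (k + 1)) =
      ∏ i ∈ Finset.Icc 1 (n - 1), (1 + ∑ r ∈ {r : Fin n | n - i + 1 ≤ (r : ℕ) + 1}, s r) := by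
  rcases Nat.eq_zero_or_pos n with rfl | hn
  · simp
  obtain ⟨m, rfl⟩ := Nat.exists_eq_succ_of_ne_zero hn.ne'
  have h0 : tailSum s (m + 1) = 0 := by
    rw [tailSum, Finset.sum_eq_zero]
    intro i hi
    have := (Finset.mem_filter.1 hi).2
    omega
  rw [Finset.prod_range_succ, h0, add_zero, mul_one]
  refine Finset.prod_nbij' (fun k => m - k) (fun i => m - i) ?_ ?_ ?_ ?_ ?_
  · intro k hk; simp at hk ⊢; omega
  · intro i hi; simp at hi ⊢; omega
  · intro k hk; simp at hk ⊢; omega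
  · intro i hi; simp at hi ⊢; omega
  · intro k hk
    rw [tailSum]
    congr 2
    ext r
    simp at hk ⊢
    omega

end Flows

end SOruga

theorem mainTheorem9 (n : ℕ) (s : Fin n → ℕ) (hs : ∀ i, 0 < s i) :
    Nonempty (SOruga.stirlingPerms s ≃
        SOruga.integerFlows (SOruga.oruga s) (SOruga.dNetflow s)) ∧
      SOruga.normalizedVolume
          (SOruga.flowPolytope (SOruga.oruga s) (SOruga.unitNetflow n)) =
        ((SOruga.decreasingTrees s).ncard : ℝ≥0∞) ∧
      (SOruga.decreasingTrees s).ncard = (SOruga.stirlingPerms s).ncard ∧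
      (SOruga.stirlingPerms s).ncard =
        ∏ i ∈ Finset.Icc 1 (n - 1),
          (1 + ∑ r ∈ {r : Fin n | n - i + 1 ≤ (r : ℕ) + 1}, s r) := by
  have h1 := SOruga.ncard_stirlingPerms s hs
  have h2 := SOruga.ncard_decreasingTrees s
  refine ⟨?_, by rw [SOruga.normalizedVolume_flowPolytope s hs, h2], h2.trans h1.symm,
    h1.trans (SOruga.prod_tailSum_eq s)⟩
  have e := SOruga.bumpEquiv s
  have h3 : Nat.card (SOruga.stirlingPerms s) =
      Nat.card ((i : Fin n) → Fin (SOruga.tailSum s (i + 1) + 1)) := by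
    rw [Nat.card_coe_set_eq, h1, Nat.card_pi]
    simp only [Nat.card_eq_fintype_card, Fintype.card_fin, add_comm 1]
    exact Finset.prod_range fun k => SOruga.tailSum s (k + 1) + 1
  have : Finite (SOruga.stirlingPerms s) := Nat.finite_of_card_ne_zero <| by
    rw [h3]
    exact Nat.card_pos.ne'
  exact (Finite.card_eq.1 h3).map fun e' => e'.trans e
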